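/- Let $R=\{\pm\epsilon,\pm2\epsilon\}$ be the root system of type $BC_1$, with weight lattice $P=\mathbb{Z}\epsilon$, dominant weights $P^+=\mathbb{Z}_{\ge 0}\,\epsilon$ and Weyl group $W=\{1,s\}$, $s\epsilon=-\epsilon$. A root multiplicity is a pair $k=(k_1,k_2)$ ($k_1$ is the value on $\pm\epsilon$, $k_2$ the value on $\pm2\epsilon$), and $\rho(k)=\tfrac12(k_1+2k_2)$. On $\mathbb{C}[z^{\pm1}]$ consider the pairing $$(f,g)_k=\int_{S^1}\overline{f(z)}\,g(z)\,\delta_k(z)\,\frac{dz}{iz},\qquad \delta_k(z)=\Bigl(1-\tfrac{z+z^{-1}}2\Bigr)^{k_1}\Bigl(1-\tfrac{z^2+z^{-2}}2\Bigr)^{k_2}.$$ For $k_1,k_2\ge0$ let $E(n,k)$, $n\in\mathbb{Z}$, be the non-symmetric Jacobi polynomials, obtained by applying the (non-normalised) Gram–Schmidt process for $(\cdot,\cdot)_k$ to the ordered basis $(1,z,z^{-1},z^2,z^{-2},\ldots)$; thus $E(n,k)=z^n+{}$lower order terms, and $E(n,k)$ is orthogonal to every monomial preceding $z^n$. For $\lambda=n\epsilon$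 write $E(\lambda,k;z)$ for the value of $E(n,k)$ at $z\in S^1$, and let $e=1\in S^1$. For $\lambda\in P$ let $\lambda^*$ be the element of $W\lambda\cap P^+$, let $w^\lambda\in W$ be the shortest element with $\lambda=w^\lambda\lambda^*$, and let $w_\lambda$ be the longest element of the stabilizer of $\lambda$ in $W$. For $m\in\mathbb{C}$ put $$\widetilde c_1(m\epsilon,k)=\frac{\Gamma(m)\,\Gamma(m+\frac12)}{2^{k_1}\,\Gamma(m+\frac12k_1+\frac12)\,\Gamma(m+\frac12k_1+k_2)},\qquad \widetilde c_s(m\epsilon,k)=\frac{\Gamma(m+\frac12)\,\Gamma(m+1)}{2^{k_1}\,\Gamma(m+\frac12k_1+\frac12)\,\Gamma(m+\frac12k_1+k_2+1)}.$$ Theorem. Let $k=(k_1,k_2)\in2\mathbb{Z}\times\mathbb{Z}$ with $k_1\ge1$ and $k_2\ge1$. Then for every $\lambda\in P$, $$E(\lambda,k;e)=\frac{\widetilde c_{w_0}(\rho(k)\epsilon,k)}{\widetilde c_{w^\lambda w_{\lambda^*}}(\lambda^*+\rho(k)\epsilon,k)},$$ where $w_0$ denotes $w_\lambda$ for $\lambda=0$,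 that is, $w_0=s$. -/

import Mathlib

open scoped ComplexConjugate

noncomputable section

namespace BC1

/-! Conventions: the weight lattice `P = ℤ ε` of the root system `{±ε, ±2ε}` is identified with `ℤ`
(`n` stands for `n ε`), its group algebra with the Laurent polynomials in `z`, and the Weyl group
`{1, s}` with `ℤˣ = {1, -1}`, acting on `ℤ` by multiplication, so that `s = -1`. -/

/-- A root multiplicity: `k.1` is the value on `±ε` and `k.2` the value on `±2ε`. -/
abbrev Mult : Type := ℂ × ℂ

/-- `ρ(k) = (k₁ + 2 k₂) / 2`. -/
def rho (k : Mult) : ℂ := (k.1 + 2 * k.2) / 2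

/-! ### The weight function, the pairing and the non-symmetric Jacobi polynomials -/

/-- The value of a Laurent polynomial at the point `z`. -/
def laurentEval (f : LaurentPolynomial ℂ) (z : ℂ) : ℂ := f.coeff.sum fun n a => a * z ^ n

/-- `δ_k(z) = (1 - (z + z⁻¹) / 2) ^ k₁ * (1 - (z² + z⁻²) / 2) ^ k₂`. -/
def weight (k : Mult) (z : ℂ) : ℂ :=
  (1 - (z + z⁻¹) / 2) ^ k.1 * (1 - (z ^ 2 + (z ^ 2)⁻¹) / 2) ^ k.2

/-- `(f, g)_k`, the integral over the unit circle of `conj (f z) * g z * δ_k z` against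
`dz / (i z)`. -/
def pairing (k : Mult) (f g : LaurentPolynomial ℂ) : ℂ :=
  ∮ z in C(0, 1),
    conj (laurentEval f z) * laurentEval g z * weight k z * (Complex.I * z)⁻¹

/-- The exponents of the ordered basis `1, z, z⁻¹, z², z⁻², …`: the `j`-th one (from `j = 0`). -/
def exponent (j : ℕ) : ℤ := if Even j then -((j / 2 : ℕ) : ℤ) else ((j + 1) / 2 : ℕ)

/-- The place of `z ^ n` in the ordered basis `1, z, z⁻¹, z², z⁻², …`. -/
def place (n : ℤ) : ℕ := if 0 < n then 2 * n.natAbs - 1 else 2 * n.natAbs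

theorem exponent_place (n : ℤ) : exponent (place n) = n := by
  unfold exponent place
  split_ifs with h1 h2 h2 <;> simp only [Nat.even_iff] at h2 <;> omega

theorem place_exponent (j : ℕ) : place (exponent j) = j := by
  unfold exponent place
  split_ifs with h1 h2 h2 <;> simp only [Nat.even_iff] at h1 <;> omega

/-- The Gram–Schmidt process (without normalisation) for the pairing `(·, ·)_k`, applied to the
ordered basis `1, z, z⁻¹, z², z⁻², …`. -/
def gramSchmidt (k : Mult) (j : ℕ) : LaurentPolynomial ℂ :=
  LaurentPolynomial.T (exponent j) -
    ∑ i : Fin j,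
      (pairing k (gramSchmidt k i) (LaurentPolynomial.T (exponent j)) /
        pairing k (gramSchmidt k i) (gramSchmidt k i)) • gramSchmidt k i
termination_by j
decreasing_by all_goals exact i.2

/-- The non-symmetric Jacobi polynomial `E(n, k) = E(n ε, k) = z ^ n + lower order terms`. -/
def jacobiE (n : ℤ) (k : Mult) : LaurentPolynomial ℂ := gramSchmidt k (place n)

/-! ### Weyl group elements attached to a weight -/

/-- The word length on `{1, s}`. -/
def len (w : ℤˣ) : ℕ := if w = 1 then 0 else 1

/-- `λ^*`, the element of the orbit of `λ` in `P⁺`. -/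
def dom (n : ℤ) : ℤ := |n|

/-- `w^λ`, the shortest element with `λ = w^λ λ^*`. -/
def wUp (n : ℤ) : ℤˣ := if 0 ≤ n then 1 else -1

/-- `w_λ`, the longest element of the stabilizer of `λ`. -/
def wStab (n : ℤ) : ℤˣ := if n = 0 then -1 else 1

theorem dom_spec (n m : ℤ) : m = dom n ↔ 0 ≤ m ∧ ∃ w : ℤˣ, m = w • n := by
  simp only [dom, Units.smul_def, smul_eq_mul]
  constructor
  · rintro rfl
    refine ⟨abs_nonneg n, ?_⟩
    rcases abs_choice n with h | h
    · exact ⟨1, by simp [h]⟩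
    · exact ⟨-1, by simp [h]⟩
  · rintro ⟨h, w, rfl⟩
    rw [← abs_of_nonneg h, abs_mul]
    rcases Int.units_eq_one_or w with rfl | rfl <;> simp

theorem wUp_spec (n : ℤ) :
    n = wUp n • dom n ∧ ∀ w : ℤˣ, n = w • dom n → len (wUp n) ≤ len w := by
  by_cases h : 0 ≤ n
  · simp [wUp, dom, len, h, abs_of_nonneg h]
  · have h' : |n| = -n := abs_of_neg (not_le.1 h)
    refine ⟨by simp [wUp, dom, h, h', Units.smul_def], fun w hw => ?_⟩
    rcases Int.units_eq_one_or w with rfl | rfl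
    · simp only [dom, h', one_smul] at hw
      omega
    · simp [wUp, h]

theorem wStab_spec (n : ℤ) :
    wStab n • n = n ∧ ∀ w : ℤˣ, w • n = n → len w ≤ len (wStab n) := by
  by_cases h : n = 0
  · subst h
    refine ⟨by simp [wStab], fun w _ => ?_⟩
    rcases Int.units_eq_one_or w with rfl | rfl <;> simp [wStab, len]
  · refine ⟨by simp [wStab, h], fun w hw => ?_⟩
    rcases Int.units_eq_one_or w with rfl | rfl
    · simp [wStab, h]
    · simp only [Units.smul_def, Units.val_neg, Units.val_one, smul_eq_mul] at hw
      omega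

/-! ### The generalized Harish-Chandra c-functions -/

/-- `c̃_w(μ, k)` for `w ∈ {1, s}`; here `m` stands for the number `μ(e₁)`, where `ε(e₁) = 1`, so
that `c̃_w(m ε, k) = cTilde w m k`. -/
def cTilde (w : ℤˣ) (m : ℂ) (k : Mult) : ℂ :=
  if w = 1 then
    Complex.Gamma m * Complex.Gamma (m + 1 / 2) /
      (2 ^ k.1 * Complex.Gamma (m + k.1 / 2 + 1 / 2) * Complex.Gamma (m + k.1 / 2 + k.2))
  else
    Complex.Gamma (m + 1 / 2) * Complex.Gamma (m + 1) /
      (2 ^ k.1 * Complex.Gamma (m + k.1 / 2 + 1 / 2) * Complex.Gamma (m + k.1 / 2 + k.2 + 1))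

/-- Away from the poles of one Gamma factor, `c̃_w` is the product over the positive roots
`α ∈ {ε, 2ε}` of `Γ(μ(α^∨) + k_{α/2}/2 + δ) / Γ(μ(α^∨) + k_{α/2}/2 + k_α + δ)`, where `δ` is `0` if
`w α > 0` and `1` if `w α < 0`. -/
theorem cTilde_eq_prod (w : ℤˣ) (m : ℂ) (k : Mult)
    (h : Complex.Gamma (m + k.1 / 2 + len w) ≠ 0) :
    cTilde w m k =
      Complex.Gamma (2 * m + len w) / Complex.Gamma (2 * m + k.1 + len w) *
        (Complex.Gamma (m + k.1 / 2 + len w) / Complex.Gamma (m + k.1 / 2 + k.2 + len w)) := by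
  have hpi : ((√Real.pi : ℝ) : ℂ) ≠ 0 := by
    exact_mod_cast (Real.sqrt_pos.2 Real.pi_pos).ne'
  have key : ∀ s t : ℂ, Complex.Gamma t ≠ 0 → t = s + k.1 / 2 → ∀ b : ℂ,
      Complex.Gamma (2 * s) / Complex.Gamma (2 * t) * (Complex.Gamma t / b) =
        Complex.Gamma s * Complex.Gamma (s + 1 / 2) /
          (2 ^ k.1 * Complex.Gamma (t + 1 / 2) * b) := by
    rintro s t ht hst b
    have h1 : (2 : ℂ) ^ (1 - 2 * s) ≠ 0 := by simp [Complex.cpow_eq_zero_iff]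
    have h2 : (2 : ℂ) ^ (1 - 2 * t) ≠ 0 := by simp [Complex.cpow_eq_zero_iff]
    have h3 : (2 : ℂ) ^ k.1 ≠ 0 := by simp [Complex.cpow_eq_zero_iff]
    have h4 : (2 : ℂ) ^ (1 - 2 * s) = 2 ^ (1 - 2 * t) * 2 ^ k.1 := by
      rw [← Complex.cpow_add _ _ two_ne_zero, hst]
      congr 1
      ring
    have e1 := Complex.Gamma_mul_Gamma_add_half s
    have e2 := Complex.Gamma_mul_Gamma_add_half t
    have e3 : Complex.Gamma (t + 1 / 2) =
        Complex.Gamma (2 * t) * (2 ^ (1 - 2 * t) * (√Real.pi : ℝ)) / Complex.Gamma t := by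
      rw [eq_div_iff ht, mul_comm, e2, mul_assoc]
    rw [e1, e3, h4]
    simp only [div_eq_mul_inv, mul_inv, inv_inv]
    field_simp
  by_cases hw : w = 1
  · have hl : ((len w : ℕ) : ℂ) = 0 := by simp [len, hw]
    rw [hl] at h ⊢
    simp only [add_zero] at h ⊢
    have := key m (m + k.1 / 2) h rfl (Complex.Gamma (m + k.1 / 2 + k.2))
    rw [show 2 * (m + k.1 / 2) = 2 * m + k.1 by ring] at this
    rw [this, cTilde, if_pos hw]
  · have hl : ((len w : ℕ) : ℂ) = 1 := by simp [len, hw]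
    rw [hl] at h ⊢
    have key2 : Complex.Gamma (m + k.1 / 2 + 1) ≠ 0 := h
    have h3 : (2 : ℂ) ^ k.1 ≠ 0 := by simp [Complex.cpow_eq_zero_iff]
    by_cases hh : Complex.Gamma (m + k.1 / 2 + 1 / 2) = 0
    · have e := Complex.Gamma_mul_Gamma_add_half (m + k.1 / 2 + 1 / 2)
      have h2 : (2 : ℂ) ^ (1 - 2 * (m + k.1 / 2 + 1 / 2)) ≠ 0 := by
        simp [Complex.cpow_eq_zero_iff]
      rw [hh, zero_mul] at e
      have h0 : Complex.Gamma (2 * (m + k.1 / 2 + 1 / 2)) = 0 :=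
        (mul_eq_zero.1 ((mul_eq_zero.1 e.symm).resolve_right hpi)).resolve_right h2
      rw [show 2 * (m + k.1 / 2 + 1 / 2) = 2 * m + k.1 + 1 by ring] at h0
      rw [cTilde, if_neg hw, hh, h0]
      simp
    · have e := key (m + 1 / 2) (m + k.1 / 2 + 1 / 2) hh (by ring) 1
      rw [show 2 * (m + k.1 / 2 + 1 / 2) = 2 * m + k.1 + 1 by ring,
        show 2 * (m + 1 / 2) = 2 * m + 1 by ring,
        show m + 1 / 2 + 1 / 2 = m + 1 by ring,
        show m + k.1 / 2 + 1 / 2 + 1 / 2 = m + k.1 / 2 + 1 by ring, div_one, mul_one] at e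
      rw [cTilde, if_neg hw, ← mul_div_assoc, eq_div_of_mul_eq hh e]
      generalize Complex.Gamma (m + k.1 / 2 + 1) = a at *
      generalize Complex.Gamma (m + k.1 / 2 + 1 / 2) = b at *
      generalize Complex.Gamma (m + k.1 / 2 + k.2 + 1) = c at *
      generalize Complex.Gamma (m + 1) = d at *
      generalize Complex.Gamma (m + 1 / 2) = f at *
      generalize (2 : ℂ) ^ k.1 = g at *
      by_cases hc : c = 0
      · simp [hc]
      · field_simp

end BC1

end

noncomputable section

namespace BC1

open LaurentPolynomial

/-! The polynomials E(n,k) are the eigenfunctions of a Cherednik operator Y, and intertwiners build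
each from its predecessor. Write a = k₁, b = k₂ and 2ρ = a + 2b. The operator Y + ρ is z d/dz plus a
difference part; multiplying by 1 - z⁻² clears its denominators (`cherednikNum`). If f is an
eigenfunction, so are f(z⁻¹) + g f and z f(z⁻¹) + d f for suitable constants g and d
(`IsCherednikEigen.reflect`, `IsCherednikEigen.affineReflect`). Alternating the two from f = 1 gives
`jacobiSeq`, whose leading exponents run through 0, 1, -1, 2, -2, ….

Y is symmetric for the pairing (`constTerm_cherednikNum`) and the eigenvalues are distinct, so the
sequence is orthogonal. Being unitriangular in the monomials, it is the output of Gram–Schmidt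
(`jacobiSeq_eq`, `gramSchmidt_eq`).

At z = 1 both reflections are invisible, so each step multiplies the value by 1 + d or 1 + g. These
factors are ratios of consecutive c-functions, and the product telescopes (`evalAt_one_jacobiSeq`).
-/

/-! ### Euler operator and constant term. -/

/-- The Euler operator `z d/dz` on Laurent polynomials. -/
def euler : ℝ[T;T⁻¹] →ₗ[ℝ] ℝ[T;T⁻¹] where
  toFun f := .ofCoeff (Finsupp.onFinset f.coeff.support (fun n => n * f.coeff n) (by
    intro n hn
    simp only [Finsupp.mem_support_iff]
    exact right_ne_zero_of_mul hn))
  map_add' f g := by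
    ext n
    simp [mul_add]
  map_smul' c f := by
    ext n
    simp [mul_left_comm]

theorem coeff_euler (f : ℝ[T;T⁻¹]) (n : ℤ) : (euler f).coeff n = n * f.coeff n := rfl

theorem euler_C_mul_T (a : ℝ) (n : ℤ) : euler (C a * T n) = C (n : ℝ) * (C a * T n) := by
  rw [← mul_assoc, ← map_mul, ← single_eq_C_mul_T, ← single_eq_C_mul_T]
  ext m
  rw [coeff_euler]
  simp only [AddMonoidAlgebra.coeff_single, Finsupp.single_apply]
  split_ifs with h
  · rw [h]
  · simp

theorem euler_T (n : ℤ) : euler (T n) = C (n : ℝ) * T n := by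
  simpa using euler_C_mul_T 1 n

theorem euler_mul (f g : ℝ[T;T⁻¹]) : euler (f * g) = euler f * g + f * euler g := by
  induction f using LaurentPolynomial.induction_on' with
  | add p q hp hq => simp only [add_mul, map_add, hp, hq]; ring
  | C_mul_T n a =>
    induction g using LaurentPolynomial.induction_on' with
    | add p q hp hq => simp only [mul_add, map_add, hp, hq]; ring
    | C_mul_T m b =>
      rw [show C a * T n * (C b * T m) = C (a * b) * T (n + m) by rw [map_mul, T_add]; ring,
        euler_C_mul_T, euler_C_mul_T, euler_C_mul_T, T_add]
      push_cast [map_add, map_mul]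
      ring

theorem euler_pow_succ (f : ℝ[T;T⁻¹]) (n : ℕ) :
    euler (f ^ (n + 1)) = (n + 1 : ℝ[T;T⁻¹]) * f ^ n * euler f := by
  induction n with
  | zero => simp
  | succ n ih => rw [pow_succ, euler_mul, ih]; push_cast; ring

theorem euler_invert (f : ℝ[T;T⁻¹]) : euler (invert f) = -invert (euler f) := by
  ext n
  simp [coeff_euler]

/-- The constant term of a Laurent polynomial. -/
def constTerm : ℝ[T;T⁻¹] →ₗ[ℝ] ℝ where
  toFun f := f.coeff 0
  map_add' f g := by simp
  map_smul' c f := by simp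

theorem constTerm_apply (f : ℝ[T;T⁻¹]) : constTerm f = f.coeff 0 := rfl

theorem constTerm_euler (f : ℝ[T;T⁻¹]) : constTerm (euler f) = 0 := by
  simp [constTerm_apply, coeff_euler]

theorem constTerm_invert (f : ℝ[T;T⁻¹]) : constTerm (invert f) = constTerm f := by
  simp [constTerm_apply]

theorem constTerm_C_mul (a : ℝ) (f : ℝ[T;T⁻¹]) : constTerm (C a * f) = a * constTerm f := by
  rw [← smul_eq_C_mul, map_smul, smul_eq_mul]

/-- The constant term is the sum of the squares of the real coefficients of `f`. -/
theorem constTerm_mul_invert_self_pos {f : ℝ[T;T⁻¹]} (hf : f ≠ 0) :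
    0 < constTerm (f * invert f) := by
  have h : ∀ g : ℝ[T;T⁻¹], constTerm (g * invert f) = g.coeff.sum fun n a => a * f.coeff n := by
    intro g
    induction g using LaurentPolynomial.induction_on' with
    | add p q hp hq =>
      rw [add_mul, map_add, hp, hq, AddMonoidAlgebra.coeff_add, Finsupp.sum_add_index']
      · simp
      · intros; ring
    | C_mul_T n a =>
      rw [← single_eq_C_mul_T, constTerm_apply, AddMonoidAlgebra.coeff_single,
        Finsupp.sum_single_index (by simp), AddMonoidAlgebra.coeff_single_mul_apply]
      simp
  rw [h]
  refine Finset.sum_pos (fun n hn => ?_) ?_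
  · exact mul_self_pos.2 (Finsupp.mem_support_iff.1 hn)
  · rw [Finsupp.support_nonempty_iff]
    intro h0
    exact hf (by ext n; simp [h0])

/-! ### The weight as a Laurent polynomial. -/

/-- The weight, up to the factor `2 ^ (k₁ + k₂)`, as a Laurent polynomial. -/
def weightPoly (p q : ℕ) : ℝ[T;T⁻¹] := (2 - T 1 - T (-1)) ^ p * (2 - T 2 - T (-2)) ^ q

theorem C_two : (C 2 : ℝ[T;T⁻¹]) = 2 := map_ofNat _ 2

theorem T_one_mul_T_neg_one : (T 1 : ℝ[T;T⁻¹]) * T (-1) = 1 := by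
  rw [← T_add]; simp

theorem T_two : (T 2 : ℝ[T;T⁻¹]) = T 1 ^ 2 := by rw [T_pow]; simp

theorem T_neg_two : (T (-2) : ℝ[T;T⁻¹]) = T (-1) ^ 2 := by rw [T_pow]; simp

theorem invert_two : invert (2 : ℝ[T;T⁻¹]) = 2 := map_ofNat _ 2

theorem invert_weightPoly (p q : ℕ) : invert (weightPoly p q) = weightPoly p q := by
  simp only [weightPoly, map_mul, map_pow, map_sub, invert_T, invert_two, neg_neg]
  ring

/-- The factor split off is what clears the denominator 1 - z⁻² of Y on either side of the form. -/
theorem weightPoly_succ (p q : ℕ) :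
    weightPoly p (q + 1) = (1 - T (-2)) * (1 - T 2) * weightPoly p q := by
  have h := T_one_mul_T_neg_one
  have e : (2 - T 2 - T (-2) : ℝ[T;T⁻¹]) = (1 - T (-2)) * (1 - T 2) := by
    rw [T_two, T_neg_two]
    linear_combination (-1 - T 1 * T (-1)) * h
  rw [weightPoly, weightPoly, pow_succ, e]
  ring

theorem weightPoly_eq_mul_invert (p q : ℕ) :
    weightPoly p q = ((1 - T 1) ^ p * (1 - T 2) ^ q) * invert ((1 - T 1) ^ p * (1 - T 2) ^ q) := by
  have h := T_one_mul_T_neg_one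
  have e : (2 - T 2 - T (-2) : ℝ[T;T⁻¹]) = (1 - T 2) * (1 - T (-2)) := by
    rw [T_two, T_neg_two]
    linear_combination (-1 - T 1 * T (-1)) * h
  have e' : (2 - T 1 - T (-1) : ℝ[T;T⁻¹]) = (1 - T 1) * (1 - T (-1)) := by
    linear_combination - h
  simp only [map_mul, map_pow, map_sub, map_one, invert_T]
  rw [weightPoly, e, e', mul_pow, mul_pow]
  ring

/-- The bracket is `dunklCoeff (p + 1) (q + 1) * (1 - T 2)` minus its image under z ↦ z⁻¹; this is
what makes Y symmetric. -/
theorem euler_weightPoly (p q : ℕ) :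
    euler (weightPoly (p + 1) (q + 1)) = weightPoly (p + 1) q *
      ((p + 1 : ℝ[T;T⁻¹]) * ((1 + T (-1)) * (1 - T 2) - (1 + T 1) * (1 - T (-2))) +
        2 * (q + 1 : ℝ[T;T⁻¹]) * (T (-2) - T 2)) := by
  have h := T_one_mul_T_neg_one
  have e2 : euler (2 : ℝ[T;T⁻¹]) = 0 := by
    have := euler_C_mul_T 2 0
    rwa [T_zero, mul_one, Int.cast_zero, map_zero, zero_mul, map_ofNat] at this
  have a1 : euler (2 - T 1 - T (-1)) = (T (-1) - T 1 : ℝ[T;T⁻¹]) := by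
    simp [euler_T, e2]; ring
  have a2 : euler (2 - T 2 - T (-2)) = (2 * (T (-2) - T 2) : ℝ[T;T⁻¹]) := by
    simp [euler_T, e2, C_two]; ring
  rw [weightPoly, euler_mul, euler_pow_succ, euler_pow_succ, a1, a2, weightPoly, T_two, T_neg_two]
  set u : ℝ[T;T⁻¹] := T 1
  set v : ℝ[T;T⁻¹] := T (-1)
  have e : (2 - u ^ 2 - v ^ 2) * (v - u) =
      (2 - u - v) * ((1 + v) * (1 - u ^ 2) - (1 + u) * (1 - v ^ 2)) := by
    grind
  rw [pow_succ (2 - u ^ 2 - v ^ 2), pow_succ (2 - u - v)]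
  linear_combination (p + 1 : ℝ[T;T⁻¹]) * (2 - u - v) ^ p * (2 - u ^ 2 - v ^ 2) ^ q * e

/-! ### The Cherednik operator and its intertwiners. -/

/-- `k₁ (1 + z⁻¹) + 2 k₂`. -/
def dunklCoeff (a b : ℝ) : ℝ[T;T⁻¹] := C a * (1 + T (-1)) + 2 * C b

/-- `(1 - z⁻²) (Y + ρ)`, where `Y` is the Cherednik operator of type `BC₁`. -/
def cherednikNum (a b : ℝ) (f : ℝ[T;T⁻¹]) : ℝ[T;T⁻¹] :=
  (1 - T (-2)) * euler f + dunklCoeff a b * (f - invert f)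

/-- `f` is an eigenvector of `Y + ρ` with eigenvalue `l`, or `0`. -/
def IsCherednikEigen (a b : ℝ) (f : ℝ[T;T⁻¹]) (l : ℝ) : Prop :=
  cherednikNum a b f = C l * (1 - T (-2)) * f

theorem isCherednikEigen_one (a b : ℝ) : IsCherednikEigen a b 1 0 := by
  have := euler_T 0
  simp at this
  simp [IsCherednikEigen, cherednikNum, this]

theorem invert_invert (f : ℝ[T;T⁻¹]) : invert (invert f) = f := involutive_invert f

theorem invert_dunklCoeff (a b : ℝ) :
    invert (dunklCoeff a b) = C a * (1 + T 1) + 2 * C b := by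
  simp [dunklCoeff, invert_two]

theorem IsCherednikEigen.invert_eq {a b l : ℝ} {f : ℝ[T;T⁻¹]} (h : IsCherednikEigen a b f l) :
    -((1 - T 2) * invert (euler f)) =
      -(C l * (1 - T 2) * invert f) + (C a * (1 + T 1) + 2 * C b) * (invert f - f) := by
  have := congrArg invert h
  simp only [cherednikNum, map_add, map_mul, map_sub, invert_invert, invert_dunklCoeff, map_one,
    invert_T, neg_neg, invert_C] at this
  linear_combination -this

theorem IsCherednikEigen.reflect {a b l g : ℝ} {f : ℝ[T;T⁻¹]} (h : IsCherednikEigen a b f l)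
    (hg : g * (2 * l - (a + 2 * b)) = a + 2 * b) :
    IsCherednikEigen a b (invert f + C g * f) (a + 2 * b - l) := by
  have h1 := h.invert_eq
  have hT := T_one_mul_T_neg_one
  have hg' := congrArg (C : ℝ →+* ℝ[T;T⁻¹]) hg
  simp only [map_mul, map_sub, map_add, C_two] at hg'
  unfold IsCherednikEigen cherednikNum dunklCoeff at h ⊢
  have e : euler (C g * f) = C g * euler f := by rw [← smul_eq_C_mul, map_smul, smul_eq_C_mul]
  rw [map_add, e, euler_invert]
  simp only [map_add, map_mul, map_sub, invert_invert, invert_C, C_two]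
  rw [T_two] at h1
  rw [T_neg_two] at h ⊢
  set u : ℝ[T;T⁻¹] := T 1
  set v : ℝ[T;T⁻¹] := T (-1)
  have hT2 : u ^ 2 * v ^ 2 = 1 := by rw [← mul_pow, hT, one_pow]
  generalize invert (euler f) = X at *
  generalize invert f = F at *
  -- Multiplying the inverted equation by z⁻² turns 1 - z² into -(1 - z⁻²), the denominator of the
  -- original; the leftover multiple of `f` is killed by the choice of `g`.
  linear_combination C g * h - v ^ 2 * h1 + (X - C l * F) * hT2 - (F - f) * C a * v * hT +
    (1 - v ^ 2) * f * hg'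

theorem IsCherednikEigen.affineReflect {a b l d : ℝ} {f : ℝ[T;T⁻¹]}
    (h : IsCherednikEigen a b f l) (hd : d * (1 + (a + 2 * b) - 2 * l) = a) :
    IsCherednikEigen a b (T 1 * invert f + C d * f) (1 + (a + 2 * b) - l) := by
  have h1 := h.invert_eq
  have hT := T_one_mul_T_neg_one
  have hd' := congrArg (C : ℝ →+* ℝ[T;T⁻¹]) hd
  simp only [map_mul, map_sub, map_add, C_two, map_one] at hd'
  unfold IsCherednikEigen cherednikNum dunklCoeff at h ⊢
  have e : euler (C d * f) = C d * euler f := by rw [← smul_eq_C_mul, map_smul, smul_eq_C_mul]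
  have e1 : euler (T 1) = (T 1 : ℝ[T;T⁻¹]) := by simp [euler_T]
  rw [map_add, e, euler_mul, euler_invert, e1]
  simp only [map_add, map_mul, map_sub, invert_invert, invert_C, C_two, map_one, invert_T]
  rw [T_two] at h1
  rw [T_neg_two] at h ⊢
  set u : ℝ[T;T⁻¹] := T 1
  set v : ℝ[T;T⁻¹] := T (-1)
  have hT2 : u ^ 2 * v ^ 2 = 1 := by rw [← mul_pow, hT, one_pow]
  generalize invert (euler f) = X at *
  generalize invert f = F at *
  -- As for `reflect`, with an extra factor z; differentiating that factor shifts the eigenvalue by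
  -- 1.
  linear_combination C d * h - u * v ^ 2 * h1 + (u * (X - C l * F) - (F - f) * C a) * hT2 +
    (C a * F + (C a + 2 * C b) * v * F - (F - f) * (C a + 2 * C b) * v) * hT -
    (1 - v ^ 2) * f * hd'

/-! ### The form, its positivity, and the symmetry of the Cherednik operator. -/

/-- The bilinear form `(f, g) ↦ CT (f* g w)`. -/
def form (p q : ℕ) (f : ℝ[T;T⁻¹]) : ℝ[T;T⁻¹] →ₗ[ℝ] ℝ :=
  constTerm ∘ₗ LinearMap.mulLeft ℝ (invert f * weightPoly p q)

theorem form_apply (p q : ℕ) (f g : ℝ[T;T⁻¹]) :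
    form p q f g = constTerm (invert f * weightPoly p q * g) := rfl

theorem form_comm (p q : ℕ) (f g : ℝ[T;T⁻¹]) : form p q f g = form p q g f := by
  rw [form_apply, form_apply, ← constTerm_invert]
  simp only [map_mul, invert_invert, invert_weightPoly]
  congr 1
  ring

theorem one_sub_T_ne_zero {n : ℤ} (hn : n ≠ 0) : (1 - T n : ℝ[T;T⁻¹]) ≠ 0 := by
  intro h
  have h0 : (1 - T n : ℝ[T;T⁻¹]).coeff 0 = 0 := by rw [h]; rfl
  rw [← T_zero, AddMonoidAlgebra.coeff_sub, Finsupp.sub_apply, T_apply, T_apply, if_neg hn] at h0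
  simp at h0

/-- The weight is h(z) h(z⁻¹) with h = (1 - z)^p (1 - z²)^q, so the form is a sum of squares. -/
theorem form_self_pos (p q : ℕ) {f : ℝ[T;T⁻¹]} (hf : f ≠ 0) : 0 < form p q f f := by
  have h : f * ((1 - T 1) ^ p * (1 - T 2) ^ q) ≠ 0 :=
    mul_ne_zero hf (mul_ne_zero (pow_ne_zero _ (one_sub_T_ne_zero one_ne_zero))
      (pow_ne_zero _ (one_sub_T_ne_zero two_ne_zero)))
  have e : invert f * weightPoly p q * f =
      (f * ((1 - T 1) ^ p * (1 - T 2) ^ q)) * invert (f * ((1 - T 1) ^ p * (1 - T 2) ^ q)) := by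
    rw [weightPoly_eq_mul_invert, map_mul invert f]
    ring
  rw [form_apply, e]
  exact constTerm_mul_invert_self_pos h

theorem constTerm_cherednikNum (p q : ℕ) (f g : ℝ[T;T⁻¹]) :
    constTerm (cherednikNum (p + 1) (q + 1) f * (1 - T 2) * invert g * weightPoly (p + 1) q) =
      constTerm ((1 - T (-2)) * f * invert (cherednikNum (p + 1) (q + 1) g) *
        weightPoly (p + 1) q) := by
  -- Integration by parts: accounts for the terms in f(z) g(z⁻¹).
  have h1 := constTerm_euler (weightPoly (p + 1) (q + 1) * (f * invert g))
  -- The remaining terms, in f(z⁻¹) g(z⁻¹) and in f(z) g(z), are exchanged by inversion and cancel.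
  have h2 := constTerm_invert ((dunklCoeff (p + 1) (q + 1)) * (1 - T 2) * invert f * invert g *
    weightPoly (p + 1) q)
  simp only [map_mul, invert_weightPoly, invert_invert, map_sub, map_one, invert_T] at h2
  rw [invert_dunklCoeff] at h2
  rw [euler_mul, euler_mul, euler_invert, euler_weightPoly, weightPoly_succ] at h1
  rw [← sub_eq_zero, ← map_sub]
  rw [← sub_eq_zero, ← map_sub] at h2
  rw [← h1, ← sub_eq_zero, ← map_sub, ← h2]
  congr 1
  simp only [cherednikNum, map_add, map_mul, map_sub, invert_invert, map_one, invert_two,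
    invert_T, invert_C, neg_neg, dunklCoeff]
  push_cast [map_natCast]
  ring

theorem form_eq_zero_of_eigen {p q : ℕ} {f g : ℝ[T;T⁻¹]} {l m : ℝ}
    (hf : IsCherednikEigen (p + 1) (q + 1) f l) (hg : IsCherednikEigen (p + 1) (q + 1) g m)
    (hlm : l ≠ m) : form (p + 1) (q + 1) f g = 0 := by
  have h := constTerm_cherednikNum p q f g
  rw [hf, hg] at h
  simp only [map_mul, invert_C, map_sub, map_one, invert_T, neg_neg] at h
  have e1 : C l * (1 - T (-2)) * f * (1 - T 2) * invert g * weightPoly (p + 1) q =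
      C l * (invert g * weightPoly (p + 1) (q + 1) * f) := by rw [weightPoly_succ]; ring
  have e2 : (1 - T (-2)) * f * (C m * (1 - T 2) * invert g) * weightPoly (p + 1) q =
      C m * (invert g * weightPoly (p + 1) (q + 1) * f) := by rw [weightPoly_succ]; ring
  rw [e1, e2, constTerm_C_mul, constTerm_C_mul, ← form_apply] at h
  rw [form_comm]
  exact (mul_eq_mul_right_iff.1 h).resolve_left hlm

/-! ### The eigenfunctions and their orthogonality. -/

/-- The non-symmetric Jacobi polynomials, produced by the intertwiners `f ↦ z f(z⁻¹)` and
`f ↦ f(z⁻¹)` in the order `1, z, z⁻¹, z², …` of their leading terms. -/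
def jacobiSeq (a b : ℝ) : ℕ → ℝ[T;T⁻¹]
  | 0 => 1
  | j + 1 =>
    if Even j then T 1 * invert (jacobiSeq a b j) + C (a / (1 + (a + 2 * b) + j)) * jacobiSeq a b j
    else invert (jacobiSeq a b j) + C ((a + 2 * b) / (j + 1 + (a + 2 * b))) * jacobiSeq a b j

/-- The eigenvalue of the Cherednik operator at `jacobiSeq a b j`. -/
def eigenvalueSeq (a b : ℝ) (j : ℕ) : ℝ :=
  if Even j then -(j / 2 : ℝ) else (j + 1) / 2 + (a + 2 * b)

theorem isCherednikEigen_jacobiSeq {a b : ℝ} (ha : 0 < a) (hb : 0 < b) (j : ℕ) :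
    IsCherednikEigen a b (jacobiSeq a b j) (eigenvalueSeq a b j) := by
  induction j with
  | zero => simpa [jacobiSeq, eigenvalueSeq] using isCherednikEigen_one a b
  | succ j ih =>
    by_cases h : Even j
    · have h' : ¬ Even (j + 1) := by simpa [Nat.even_add_one] using h
      rw [eigenvalueSeq, if_pos h] at ih
      rw [jacobiSeq, if_pos h, eigenvalueSeq, if_neg h']
      have := ih.affineReflect (d := a / (1 + (a + 2 * b) + j)) (by field_simp; ring)
      convert this using 1
      push_cast
      ring
    · have h' : Even (j + 1) := by simpa [Nat.even_add_one] using h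
      rw [eigenvalueSeq, if_neg h] at ih
      rw [jacobiSeq, if_neg h, eigenvalueSeq, if_pos h']
      have := ih.reflect (g := (a + 2 * b) / (j + 1 + (a + 2 * b))) (by field_simp; ring)
      convert this using 1
      push_cast
      ring

/-- Even places give nonpositive, strictly decreasing values; odd places give positive, strictly
increasing ones. -/
theorem eigenvalueSeq_injective {a b : ℝ} (ha : 0 < a) (hb : 0 < b) :
    Function.Injective (eigenvalueSeq a b) := by
  intro i j h
  unfold eigenvalueSeq at h
  have hi : (0 : ℝ) ≤ i := i.cast_nonneg
  have hj : (0 : ℝ) ≤ j := j.cast_nonneg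
  split_ifs at h
  · exact_mod_cast (by linarith : (i : ℝ) = j)
  · linarith
  · linarith
  · exact_mod_cast (by linarith : (i : ℝ) = j)

theorem form_jacobiSeq_of_ne (p q : ℕ) {i j : ℕ} (h : i ≠ j) :
    form (p + 1) (q + 1) (jacobiSeq (p + 1) (q + 1) i) (jacobiSeq (p + 1) (q + 1) j) = 0 :=
  have hp : (0 : ℝ) < p + 1 := by positivity
  have hq : (0 : ℝ) < q + 1 := by positivity
  form_eq_zero_of_eigen (isCherednikEigen_jacobiSeq hp hq i) (isCherednikEigen_jacobiSeq hp hq j)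
    ((eigenvalueSeq_injective hp hq).ne h)

/-! ### Triangularity and Gram–Schmidt. -/

/-- The span of the first `j` monomials. -/
def initialSpan (j : ℕ) : Submodule ℝ ℝ[T;T⁻¹] :=
  Submodule.span ℝ ((fun i => T (exponent i)) '' Set.Iio j)

theorem initialSpan_mono {i j : ℕ} (h : i ≤ j) : initialSpan i ≤ initialSpan j :=
  Submodule.span_mono (Set.image_mono (Set.Iio_subset_Iio h))

theorem T_exponent_mem_initialSpan {i j : ℕ} (h : i < j) : T (exponent i) ∈ initialSpan j :=
  Submodule.subset_span ⟨i, h, rfl⟩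

theorem T_mem_initialSpan {n : ℤ} {j : ℕ} (h : place n < j) : T n ∈ initialSpan j := by
  simpa [exponent_place] using T_exponent_mem_initialSpan h

/-- For even `j` the first `j` exponents are an interval symmetric about 1/2, hence stable under n ↦
1 - n. For odd `j` the interval is symmetric about 0, as used for `invert_mem_initialSpan`. -/
theorem affineReflect_mem_initialSpan {j : ℕ} (hj : Even j) {f : ℝ[T;T⁻¹]}
    (hf : f ∈ initialSpan j) : T 1 * invert f ∈ initialSpan j := by
  have : initialSpan j ≤ (initialSpan j).comap
      (LinearMap.mulLeft ℝ (T 1 : ℝ[T;T⁻¹]) ∘ₗ (invert (R := ℝ)).toLinearMap) := by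
    refine Submodule.span_le.2 ?_
    rintro _ ⟨i, hi, rfl⟩
    simp only [SetLike.mem_coe, Submodule.mem_comap, LinearMap.comp_apply,
      AlgEquiv.toLinearMap_apply, LinearMap.mulLeft_apply, invert_T, ← T_add]
    refine T_mem_initialSpan ?_
    rw [Set.mem_Iio] at hi
    rw [Nat.even_iff] at hj
    unfold place exponent
    simp only [Nat.even_iff]
    split_ifs <;> omega
  exact this hf

theorem invert_mem_initialSpan {j : ℕ} (hj : ¬ Even j) {f : ℝ[T;T⁻¹]}
    (hf : f ∈ initialSpan j) : invert f ∈ initialSpan j := by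
  have : initialSpan j ≤ (initialSpan j).comap (invert (R := ℝ)).toLinearMap := by
    refine Submodule.span_le.2 ?_
    rintro _ ⟨i, hi, rfl⟩
    simp only [SetLike.mem_coe, Submodule.mem_comap, AlgEquiv.toLinearMap_apply, invert_T]
    refine T_mem_initialSpan ?_
    rw [Set.mem_Iio] at hi
    rw [Nat.even_iff] at hj
    unfold place exponent
    simp only [Nat.even_iff]
    split_ifs <;> omega
  exact this hf

theorem exponent_succ_of_even {j : ℕ} (hj : Even j) : exponent (j + 1) = 1 - exponent j := by
  unfold exponent
  simp only [Nat.even_iff] at *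
  split_ifs <;> omega

theorem exponent_succ_of_not_even {j : ℕ} (hj : ¬ Even j) : exponent (j + 1) = -exponent j := by
  unfold exponent
  simp only [Nat.even_iff] at *
  split_ifs <;> omega

theorem jacobiSeq_sub_T_mem (a b : ℝ) (j : ℕ) :
    jacobiSeq a b j - T (exponent j) ∈ initialSpan j := by
  induction j with
  | zero => simp [jacobiSeq, exponent]
  | succ j ih =>
    have hmono := initialSpan_mono j.le_succ
    have hj : jacobiSeq a b j ∈ initialSpan (j + 1) := by
      simpa using add_mem (hmono ih) (T_exponent_mem_initialSpan j.lt_succ_self)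
    by_cases h : Even j
    · have h1 := hmono (affineReflect_mem_initialSpan h ih)
      rw [map_sub, invert_T, mul_sub, ← T_add, ← sub_eq_add_neg, ← exponent_succ_of_even h] at h1
      rw [jacobiSeq, if_pos h, add_sub_right_comm, ← smul_eq_C_mul]
      exact add_mem h1 (Submodule.smul_mem _ _ hj)
    · have h1 := hmono (invert_mem_initialSpan h ih)
      rw [map_sub, invert_T, ← exponent_succ_of_not_even h] at h1
      rw [jacobiSeq, if_neg h, add_sub_right_comm, ← smul_eq_C_mul]
      exact add_mem h1 (Submodule.smul_mem _ _ hj)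

theorem initialSpan_le_span_jacobiSeq (a b : ℝ) (j : ℕ) :
    initialSpan j ≤ Submodule.span ℝ (jacobiSeq a b '' Set.Iio j) := by
  induction j with
  | zero => simp [initialSpan]
  | succ j ih =>
    have hmono : Submodule.span ℝ (jacobiSeq a b '' Set.Iio j) ≤
        Submodule.span ℝ (jacobiSeq a b '' Set.Iio (j + 1)) :=
      Submodule.span_mono (Set.image_mono (Set.Iio_subset_Iio j.le_succ))
    refine Submodule.span_le.2 ?_
    rintro _ ⟨i, hi, rfl⟩
    rcases Nat.lt_succ_iff_lt_or_eq.1 hi with h | rfl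
    · exact hmono (ih (T_exponent_mem_initialSpan h))
    · have h1 := hmono (ih (jacobiSeq_sub_T_mem a b i))
      have h2 : jacobiSeq a b i ∈ Submodule.span ℝ (jacobiSeq a b '' Set.Iio (i + 1)) :=
        Submodule.subset_span ⟨i, i.lt_succ_self, rfl⟩
      simpa using sub_mem h2 h1

theorem jacobiSeq_ne_zero (a b : ℝ) (j : ℕ) : jacobiSeq a b j ≠ 0 := by
  intro h
  have h1 := jacobiSeq_sub_T_mem a b j
  rw [h, zero_sub, neg_mem_iff] at h1
  have h2 : initialSpan j ≤ LinearMap.ker ((Finsupp.lapply (exponent j) : (ℤ →₀ ℝ) →ₗ[ℝ] ℝ) ∘ₗ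
      (AddMonoidAlgebra.coeffLinearEquiv ℝ : ℝ[T;T⁻¹] ≃ₗ[ℝ] (ℤ →₀ ℝ)).toLinearMap) := by
    refine Submodule.span_le.2 ?_
    rintro _ ⟨i, hi, rfl⟩
    have : exponent i ≠ exponent j := fun h => by
      have := congrArg place h
      rw [place_exponent, place_exponent] at this
      exact (ne_of_lt hi) this
    simp [this]
  have h3 := h2 h1
  simp at h3

/-- By triangularity the monomial minus its eigenfunction lies in the span of the earlier
eigenfunctions, so it equals its orthogonal expansion there. -/
theorem jacobiSeq_eq (p q j : ℕ) :
    jacobiSeq (p + 1) (q + 1) j = T (exponent j) - ∑ i : Fin j,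
      (form (p + 1) (q + 1) (jacobiSeq (p + 1) (q + 1) i) (T (exponent j)) /
        form (p + 1) (q + 1) (jacobiSeq (p + 1) (q + 1) i) (jacobiSeq (p + 1) (q + 1) i)) •
          jacobiSeq (p + 1) (q + 1) i := by
  set e := jacobiSeq (p + 1) (q + 1) with he
  have hmem : T (exponent j) - e j ∈ Submodule.span ℝ (e '' Set.Iio j) := by
    rw [← neg_mem_iff, neg_sub]
    exact initialSpan_le_span_jacobiSeq _ _ _ (jacobiSeq_sub_T_mem _ _ _)
  have hexp : ∀ x ∈ Submodule.span ℝ (e '' Set.Iio j), x = ∑ i : Fin j,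
      (form (p + 1) (q + 1) (e i) x / form (p + 1) (q + 1) (e i) (e i)) • e i := by
    intro x hx
    induction hx using Submodule.span_induction with
    | mem x hx =>
      obtain ⟨m, hm, rfl⟩ := hx
      rw [Finset.sum_eq_single (⟨m, hm⟩ : Fin j)]
      · rw [div_self (form_self_pos _ _ (jacobiSeq_ne_zero _ _ _)).ne', one_smul]
      · intro i _ hi
        rw [he, form_jacobiSeq_of_ne, zero_div, zero_smul]
        exact fun h => hi (Fin.ext h)
      · simp
    | zero => simp
    | add x y _ _ hx hy =>
      conv_lhs => rw [hx, hy]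
      simp [add_div, add_smul, Finset.sum_add_distrib]
    | smul c x _ hx =>
      conv_lhs => rw [hx]
      simp [Finset.smul_sum, smul_smul, mul_div_assoc]
  have h := hexp _ hmem
  -- The j-th eigenfunction is orthogonal to the earlier ones, so it does not affect the
  -- coefficients.
  have h0 : ∀ i : Fin j, form (p + 1) (q + 1) (e i) (T (exponent j) - e j) =
      form (p + 1) (q + 1) (e i) (T (exponent j)) := by
    intro i
    rw [map_sub, he, form_jacobiSeq_of_ne _ _ i.2.ne, sub_zero]
  simp only [h0] at h
  rw [← h, sub_sub_cancel]

/-! ### From constant terms to integrals over the circle. -/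

/-- Extension of scalars from the real to the complex Laurent polynomials. -/
def complexify : ℝ[T;T⁻¹] →+* ℂ[T;T⁻¹] := AddMonoidAlgebra.mapRingHom ℤ Complex.ofRealHom

theorem complexify_C_mul_T (a : ℝ) (n : ℤ) : complexify (C a * T n) = C (a : ℂ) * T n := by
  rw [← single_eq_C_mul_T, ← single_eq_C_mul_T]
  exact AddMonoidAlgebra.mapRingHom_single _ _ _

theorem complexify_T (n : ℤ) : complexify (T n) = T n := by
  simpa using complexify_C_mul_T 1 n

theorem complexify_smul (a : ℝ) (f : ℝ[T;T⁻¹]) : complexify (a • f) = (a : ℂ) • complexify f := by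
  rw [smul_eq_C_mul, smul_eq_C_mul, map_mul]
  congr 1
  simpa using complexify_C_mul_T a 0

/-- Evaluation of a real Laurent polynomial at a nonzero complex number. -/
def evalAt (z : ℂˣ) : ℝ[T;T⁻¹] →+* ℂ := eval₂ Complex.ofRealHom z

theorem evalAt_T (z : ℂˣ) (n : ℤ) : evalAt z (T n) = (z : ℂ) ^ n := by
  rw [evalAt, eval₂_T, Units.val_zpow_eq_zpow_val]

theorem evalAt_C (z : ℂˣ) (a : ℝ) : evalAt z (C a) = a := eval₂_C _ _ _

theorem laurentEval_add (f g : ℂ[T;T⁻¹]) (z : ℂ) :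
    laurentEval (f + g) z = laurentEval f z + laurentEval g z := by
  unfold laurentEval
  rw [AddMonoidAlgebra.coeff_add, Finsupp.sum_add_index']
  · simp
  · intros; ring

theorem laurentEval_C_mul_T (a : ℂ) (n : ℤ) (z : ℂ) :
    laurentEval (C a * T n) z = a * z ^ n := by
  rw [← single_eq_C_mul_T, laurentEval, AddMonoidAlgebra.coeff_single, Finsupp.sum_single_index]
  simp

theorem laurentEval_complexify (f : ℝ[T;T⁻¹]) (z : ℂˣ) :
    laurentEval (complexify f) z = evalAt z f := by
  induction f using LaurentPolynomial.induction_on' with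
  | add f g hf hg => rw [map_add, laurentEval_add, hf, hg, map_add]
  | C_mul_T n a => rw [complexify_C_mul_T, laurentEval_C_mul_T, map_mul, evalAt_C, evalAt_T]

/-- The coefficients are real and conj z = z⁻¹ on the unit circle. -/
theorem conj_evalAt (f : ℝ[T;T⁻¹]) (z : ℂˣ) (hz : ‖(z : ℂ)‖ = 1) :
    conj (evalAt z f) = evalAt z (invert f) := by
  induction f using LaurentPolynomial.induction_on' with
  | add f g hf hg => simp only [map_add, hf, hg]
  | C_mul_T n a =>
    rw [map_mul invert, map_mul, map_mul, invert_C, invert_T, evalAt_C, evalAt_T,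
      map_mul (evalAt z), evalAt_C, evalAt_T, map_zpow₀, Complex.conj_ofReal, ← Complex.inv_eq_conj hz, inv_zpow, zpow_neg]

theorem weight_eq_evalAt (p q : ℕ) (z : ℂˣ) :
    weight ((p : ℂ), (q : ℂ)) z = ((2 : ℂ) ^ (p + q))⁻¹ * evalAt z (weightPoly p q) := by
  have h2 : evalAt z 2 = 2 := map_ofNat _ 2
  simp only [weight, Complex.cpow_natCast, weightPoly, map_mul, map_pow, map_sub, evalAt_T, h2]
  have e1 : 1 - ((z : ℂ) + (z : ℂ)⁻¹) / 2 = 2⁻¹ * (2 - (z : ℂ) ^ (1 : ℤ) - (z : ℂ) ^ (-1 : ℤ)) := by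
    simp
    ring
  have e2 : 1 - ((z : ℂ) ^ 2 + ((z : ℂ) ^ 2)⁻¹) / 2 =
      2⁻¹ * (2 - (z : ℂ) ^ (2 : ℤ) - (z : ℂ) ^ (-2 : ℤ)) := by
    rw [zpow_neg, zpow_ofNat]
    ring
  rw [e1, e2, mul_pow, mul_pow, pow_add, mul_inv, inv_pow, inv_pow]
  ring

theorem circleIntegral_zpow_mul (n : ℤ) :
    (∮ z in C(0, 1), z ^ n * (Complex.I * z)⁻¹) = if n = 0 then 2 * (Real.pi : ℂ) else 0 := by
  have e : (∮ z in C(0, 1), z ^ n * (Complex.I * z)⁻¹) =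
      ∮ z in C(0, 1), Complex.I⁻¹ * (z - 0) ^ (n - 1) := by
    refine circleIntegral.integral_congr zero_le_one fun z hz => ?_
    have hz0 : z ≠ 0 := by
      rintro rfl
      simp at hz
    simp only [sub_zero, zpow_sub_one₀ hz0, mul_inv]
    ring
  rw [e, circleIntegral.integral_const_mul]
  split_ifs with h
  · subst h
    have := circleIntegral.integral_sub_center_inv (0 : ℂ) one_ne_zero
    simp only [zero_sub, zpow_neg_one]
    rw [this]
    field_simp
  · rw [circleIntegral.integral_sub_zpow_of_ne (by omega), mul_zero]

theorem exists_unit_of_mem_sphere {z : ℂ} (hz : z ∈ Metric.sphere (0 : ℂ) 1) :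
    ∃ u : ℂˣ, (u : ℂ) = z ∧ ‖(u : ℂ)‖ = 1 := by
  have hn : ‖z‖ = 1 := by simpa using hz
  have hz0 : z ≠ 0 := norm_ne_zero_iff.1 (by rw [hn]; exact one_ne_zero)
  exact ⟨Units.mk0 z hz0, rfl, hn⟩

theorem circleIntegral_laurentEval (f : ℝ[T;T⁻¹]) :
    CircleIntegrable (fun z => laurentEval (complexify f) z * (Complex.I * z)⁻¹) 0 1 ∧
    (∮ z in C(0, 1), laurentEval (complexify f) z * (Complex.I * z)⁻¹) =
      2 * Real.pi * (constTerm f : ℂ) := by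
  induction f using LaurentPolynomial.induction_on' with
  | add f g hf hg =>
    simp only [map_add, laurentEval_add, add_mul]
    refine ⟨hf.1.add hg.1, ?_⟩
    rw [circleIntegral.integral_add hf.1 hg.1, hf.2, hg.2]
    push_cast
    ring
  | C_mul_T n a =>
    simp only [complexify_C_mul_T, laurentEval_C_mul_T, mul_assoc]
    constructor
    · refine ContinuousOn.circleIntegrable zero_le_one ?_
      intro z hz
      obtain ⟨u, rfl, -⟩ := exists_unit_of_mem_sphere hz
      refine (continuousAt_const.mul ((continuousAt_zpow₀ _ _ (Or.inl u.ne_zero)).mul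
        (ContinuousAt.inv₀ (by fun_prop) ?_))).continuousWithinAt
      simp
    · rw [circleIntegral.integral_const_mul, circleIntegral_zpow_mul, constTerm_C_mul,
        constTerm_apply, T_apply]
      split_ifs
      · push_cast; ring
      · simp

theorem pairing_complexify (p q : ℕ) (f g : ℝ[T;T⁻¹]) :
    pairing ((p : ℂ), (q : ℂ)) (complexify f) (complexify g) =
      ((2 : ℂ) ^ (p + q))⁻¹ * (2 * Real.pi) * (form p q f g : ℂ) := by
  rw [form_apply, mul_assoc, ← (circleIntegral_laurentEval _).2,
    ← circleIntegral.integral_const_mul, pairing]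
  refine circleIntegral.integral_congr zero_le_one fun z hz => ?_
  obtain ⟨u, rfl, hu⟩ := exists_unit_of_mem_sphere hz
  simp only [laurentEval_complexify, weight_eq_evalAt, conj_evalAt _ _ hu]
  simp only [map_mul]
  ring

/-- The pairing is a nonzero constant times the form, and the constant cancels in every Gram–Schmidt
coefficient. -/
theorem gramSchmidt_eq (p q j : ℕ) :
    gramSchmidt (((p + 1 : ℕ) : ℂ), ((q + 1 : ℕ) : ℂ)) j =
      complexify (jacobiSeq (p + 1) (q + 1) j) := by
  induction j using Nat.strong_induction_on with
  | _ j ih =>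
    have hc : ((2 : ℂ) ^ (p + 1 + (q + 1)))⁻¹ * (2 * Real.pi) ≠ 0 := by
      simp [Real.pi_ne_zero]
    rw [gramSchmidt, jacobiSeq_eq, map_sub, map_sum, complexify_T]
    congr 1
    refine Finset.sum_congr rfl fun i _ => ?_
    rw [ih i i.2, complexify_smul, ← complexify_T, pairing_complexify, pairing_complexify,
      mul_div_mul_left _ _ hc, Complex.ofReal_div]

/-! ### The value at the identity and the c-function recurrences. -/

theorem evalAt_one_invert (f : ℝ[T;T⁻¹]) : evalAt 1 (invert f) = evalAt 1 f := by
  rw [← conj_evalAt f 1 (by simp)]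
  induction f using LaurentPolynomial.induction_on' with
  | add f g hf hg => simp only [map_add, hf, hg]
  | C_mul_T n a => simp [evalAt_C, evalAt_T]

theorem evalAt_one_jacobiSeq_succ_of_even (a b : ℝ) {j : ℕ} (hj : Even j) :
    evalAt 1 (jacobiSeq a b (j + 1)) =
      (1 + a / (1 + (a + 2 * b) + j)) * evalAt 1 (jacobiSeq a b j) := by
  rw [jacobiSeq, if_pos hj]
  simp only [map_add, map_mul, evalAt_one_invert, evalAt_T, evalAt_C]
  push_cast
  simp
  ring

theorem evalAt_one_jacobiSeq_succ_of_not_even (a b : ℝ) {j : ℕ} (hj : ¬ Even j) :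
    evalAt 1 (jacobiSeq a b (j + 1)) =
      (1 + (a + 2 * b) / (j + 1 + (a + 2 * b))) * evalAt 1 (jacobiSeq a b j) := by
  rw [jacobiSeq, if_neg hj]
  simp only [map_add, map_mul, evalAt_one_invert, evalAt_C]
  push_cast
  ring

theorem cTilde_ne_zero (w : ℤˣ) {m a b : ℝ} (hm : 0 < m) (ha : 0 < a) (hb : 0 < b) :
    cTilde w m (a, b) ≠ 0 := by
  have hG : ∀ x : ℝ, 0 < x → Complex.Gamma x ≠ 0 := fun x hx => by
    rw [Complex.Gamma_ofReal]
    exact_mod_cast (Real.Gamma_pos_of_pos hx).ne'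
  have h2 : (2 : ℂ) ^ (a : ℂ) ≠ 0 := by simp [Complex.cpow_eq_zero_iff]
  have h1 := hG (m + 1 / 2) (by positivity)
  have h3 := hG (m + 1) (by positivity)
  have h4 := hG (m + a / 2 + 1 / 2) (by positivity)
  have h5 := hG (m + a / 2 + b) (by positivity)
  have h6 := hG (m + a / 2 + b + 1) (by positivity)
  push_cast at h1 h3 h4 h5 h6
  unfold cTilde
  split_ifs
  · exact div_ne_zero (mul_ne_zero (hG m hm) h1) (mul_ne_zero (mul_ne_zero h2 h4) h5)
  · exact div_ne_zero (mul_ne_zero h1 h3) (mul_ne_zero (mul_ne_zero h2 h4) h6)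

/-- Γ(x + 1) = x Γ(x) at x = m + 1/2 and x = m + a/2 + 1/2. With m = n + ρ the resulting ratio is
the evaluation factor from -n to n + 1. -/
theorem cTilde_one_add_one {m a : ℝ} (b : ℝ) (hm : 0 < m) (ha : 0 < a) :
    cTilde 1 (m + 1) (a, b) * (m + a / 2 + 1 / 2) = cTilde (-1) m (a, b) * (m + 1 / 2) := by
  have hne : ∀ x : ℝ, 0 < x → (x : ℂ) ≠ 0 := fun x hx => by exact_mod_cast hx.ne'
  have h1 := hne (m + 1 / 2) (by positivity)
  have h4 := hne (m + a / 2 + 1 / 2) (by positivity)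
  push_cast at h1 h4
  have e1 := Complex.Gamma_add_one _ h1
  have e4 := Complex.Gamma_add_one _ h4
  rw [cTilde, cTilde, if_pos rfl, if_neg (by decide)]
  dsimp only
  rw [show (m : ℂ) + 1 + 1 / 2 = m + 1 / 2 + 1 by ring, e1,
    show (m : ℂ) + 1 + a / 2 + 1 / 2 = m + a / 2 + 1 / 2 + 1 by ring, e4,
    show (m : ℂ) + 1 + a / 2 + b = m + a / 2 + b + 1 by ring]
  generalize (m : ℂ) + a / 2 + 1 / 2 = s at h4 ⊢
  field_simp

/-- The same Gamma recurrence at x = m and x = m + a/2 + b. With m = n + ρ, where ρ = a/2 + b, the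
ratio is the evaluation factor from n to -n, for n > 0. -/
theorem cTilde_one_mul {m a b : ℝ} (hm : 0 < m) (ha : 0 < a) (hb : 0 < b) :
    cTilde 1 m (a, b) * m = cTilde (-1) m (a, b) * (m + a / 2 + b) := by
  have hne : ∀ x : ℝ, 0 < x → (x : ℂ) ≠ 0 := fun x hx => by exact_mod_cast hx.ne'
  have h1 := hne m hm
  have h4 := hne (m + a / 2 + b) (by positivity)
  push_cast at h1 h4
  have e1 := Complex.Gamma_add_one _ h1
  have e4 := Complex.Gamma_add_one _ h4
  rw [cTilde, cTilde, if_pos rfl, if_neg (by decide)]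
  dsimp only
  rw [e1, e4]
  generalize (m : ℂ) + a / 2 + b = s at h4 ⊢
  field_simp

theorem evalAt_one_jacobiSeq {a b : ℝ} (ha : 0 < a) (hb : 0 < b) (n : ℕ) :
    evalAt 1 (jacobiSeq a b (2 * n)) * cTilde (-1) ((n + (a + 2 * b) / 2 : ℝ) : ℂ) (a, b) =
        cTilde (-1) (((a + 2 * b) / 2 : ℝ) : ℂ) (a, b) ∧
      evalAt 1 (jacobiSeq a b (2 * n + 1)) *
          cTilde 1 (((n + 1 : ℕ) + (a + 2 * b) / 2 : ℝ) : ℂ) (a, b) =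
        cTilde (-1) (((a + 2 * b) / 2 : ℝ) : ℂ) (a, b) := by
  have hstep : ∀ n : ℕ,
      evalAt 1 (jacobiSeq a b (2 * n + 1)) *
          cTilde 1 (((n + 1 : ℕ) + (a + 2 * b) / 2 : ℝ) : ℂ) (a, b) =
        evalAt 1 (jacobiSeq a b (2 * n)) *
          cTilde (-1) ((n + (a + 2 * b) / 2 : ℝ) : ℂ) (a, b) := by
    intro n
    rw [evalAt_one_jacobiSeq_succ_of_even a b (by simp)]
    have hd : ((1 + (a + 2 * b) + (2 * n : ℕ) : ℝ) : ℂ) ≠ 0 := by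
      norm_cast
      positivity
    have h := cTilde_one_add_one (m := n + (a + 2 * b) / 2) b (by positivity) ha
    rw [show (((n + 1 : ℕ) + (a + 2 * b) / 2 : ℝ) : ℂ) =
      ((n + (a + 2 * b) / 2 : ℝ) : ℂ) + 1 by push_cast; ring]
    generalize cTilde 1 (((n + (a + 2 * b) / 2 : ℝ) : ℂ) + 1) (a, b) = X at *
    generalize cTilde (-1) ((n + (a + 2 * b) / 2 : ℝ) : ℂ) (a, b) = Y at *
    generalize evalAt 1 (jacobiSeq a b (2 * n)) = E
    push_cast at hd h ⊢
    field_simp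
    linear_combination 2 * E * h
  induction n with
  | zero =>
    have h0 : evalAt 1 (jacobiSeq a b (2 * 0)) *
        cTilde (-1) (((0 : ℕ) + (a + 2 * b) / 2 : ℝ) : ℂ) (a, b) =
        cTilde (-1) (((a + 2 * b) / 2 : ℝ) : ℂ) (a, b) := by simp [jacobiSeq]
    exact ⟨h0, (hstep 0).trans h0⟩
  | succ n ih =>
    -- `hstep` yields the odd place from the even one, so only the passage from place 2n + 1 to 2n +
    -- 2 remains.
    refine and_iff_left_of_imp (fun h => (hstep (n + 1)).trans h) |>.2 ?_
    rw [← ih.2, show 2 * (n + 1) = 2 * n + 1 + 1 by ring,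
      evalAt_one_jacobiSeq_succ_of_not_even a b (by simp)]
    have hd : (((2 * n + 1 : ℕ) + 1 + (a + 2 * b) : ℝ) : ℂ) ≠ 0 := by
      norm_cast
      positivity
    have h := cTilde_one_mul (m := (n + 1 : ℕ) + (a + 2 * b) / 2) (by positivity) ha hb
    generalize cTilde 1 (((n + 1 : ℕ) + (a + 2 * b) / 2 : ℝ) : ℂ) (a, b) = X at *
    generalize cTilde (-1) (((n + 1 : ℕ) + (a + 2 * b) / 2 : ℝ) : ℂ) (a, b) = Y at *
    generalize evalAt 1 (jacobiSeq a b (2 * n + 1)) = E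
    push_cast at hd h ⊢
    field_simp
    linear_combination -2 * E * h

end BC1

end

/-! ### The evaluation formula. -/

theorem mainTheorem10 (k₁ k₂ : ℤ) (hk₁_even : Even k₁) (hk₁ : 1 ≤ k₁) (hk₂ : 1 ≤ k₂)
    (k : BC1.Mult) (hk : k = ((k₁ : ℂ), (k₂ : ℂ))) (lam : ℤ) :
    BC1.laurentEval (BC1.jacobiE lam k) ((1 : Circle) : ℂ) =
      BC1.cTilde (BC1.wStab 0) (BC1.rho k) k /
        BC1.cTilde (BC1.wUp lam * BC1.wStab (BC1.dom lam)) (BC1.dom lam + BC1.rho k) k := by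
  obtain ⟨p, rfl⟩ : ∃ p : ℕ, k₁ = (p + 1 : ℕ) := ⟨(k₁ - 1).toNat, by omega⟩
  obtain ⟨q, rfl⟩ : ∃ q : ℕ, k₂ = (q + 1 : ℕ) := ⟨(k₂ - 1).toNat, by omega⟩
  rw [Int.cast_natCast, Int.cast_natCast] at hk
  have hp : (0 : ℝ) < p + 1 := by positivity
  have hq : (0 : ℝ) < q + 1 := by positivity
  have hk' : k = (((p + 1 : ℝ) : ℂ), ((q + 1 : ℝ) : ℂ)) := by rw [hk]; push_cast; rfl
  have hrho : BC1.rho k = ((((p + 1) + 2 * (q + 1)) / 2 : ℝ) : ℂ) := by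
    rw [hk', BC1.rho]; push_cast; rfl
  have hE : BC1.laurentEval (BC1.jacobiE lam k) ((1 : Circle) : ℂ) =
      BC1.evalAt 1 (BC1.jacobiSeq (p + 1) (q + 1) (BC1.place lam)) := by
    rw [BC1.jacobiE, hk, BC1.gramSchmidt_eq, ← BC1.laurentEval_complexify]
    simp
  have hadd : (BC1.dom lam : ℂ) + BC1.rho k =
      ((lam.natAbs + ((p + 1) + 2 * (q + 1)) / 2 : ℝ) : ℂ) := by
    rw [hrho, BC1.dom, Complex.ofReal_add, Nat.cast_natAbs, Complex.ofReal_intCast]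
  have hs : BC1.wStab 0 = -1 := by simp [BC1.wStab]
  rw [hE, hadd, hrho, hk', hs, eq_div_iff (BC1.cTilde_ne_zero _ (by positivity) hp hq)]
  by_cases h : 0 < lam
  · have hw : BC1.wUp lam * BC1.wStab (BC1.dom lam) = 1 := by
      simp [BC1.wUp, BC1.wStab, BC1.dom, h.le, h.ne']
    obtain ⟨n, rfl⟩ : ∃ n : ℕ, lam = (n + 1 : ℕ) := ⟨(lam - 1).toNat, by omega⟩
    have hpl : BC1.place ((n + 1 : ℕ) : ℤ) = 2 * n + 1 := by
      rw [BC1.place, if_pos h, Int.natAbs_natCast]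
      omega
    rw [hw, hpl, Int.natAbs_natCast]
    exact (BC1.evalAt_one_jacobiSeq hp hq n).2
  -- λ = 0 joins the negative weights: there `wUp` is trivial but the stabilizer contributes s,
  -- while for λ < 0 it is the other way round.
  · have hw : BC1.wUp lam * BC1.wStab (BC1.dom lam) = -1 := by
      rcases (not_lt.1 h).lt_or_eq with h' | rfl
      · simp [BC1.wUp, BC1.wStab, BC1.dom, not_le.2 h', h'.ne]
      · simp [BC1.wUp, BC1.wStab, BC1.dom]
    rw [hw, BC1.place, if_neg h]
    exact (BC1.evalAt_one_jacobiSeq hp hq lam.natAbs).1
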